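/- Let $X$ be a real Hilbert space, let $A,B\colon X\rightrightarrows X$ be maximally monotone operators such that $A+B$ is maximally monotone, and let $w\in X$. Write $\operatorname{zer} C=\{x\in X : 0\in Cx\}$ for an operator $C\colon X\rightrightarrows X$. For $\gamma\in\left]0,1\right[$ let $A_\gamma$ and $B_\gamma$ be the resolvent averages of $A$ and $B$ with the normal cone operator $N_{\{w\}}$, i.e. $$A_\gamma x = A\big(\gamma^{-1}(x-(1-\gamma)w)\big)+\gamma^{-1}(1-\gamma)(x-w),\qquad B_\gamma x = B\big(\gamma^{-1}(x-(1-\gamma)w)\big)+\gamma^{-1}(1-\gamma)(x-w)\qquad(x\in X).$$ Then for every $\gamma\in\left]0,1\right[$ the operator $A_\gamma+B_\gamma$ has exactly one zero $z_\gamma$, and exactly one of the following holds: 1. $\operatorname{zer}(A+B)\neq\varnothing$ and $z_\gamma\to P_{\operatorname{zer}(A+B)}w$ as $\gamma\to1^-$, where $P_{\operatorname{zer}(A+B)}w$ denotes the unique point of $\operatorname{zer}(A+B)$ nearest to $w$ (which exists in this case). 2. $\operatorname{zer}(A+B)=\varnothing$ and $\|z_\gamma\|\to\infty$ as $\gamma\to1^-$.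 -/

import Mathlib

open Filter Set
open scoped Topology Pointwise

namespace SetValuedOp

/-- The set-valued operator `A : X ⇉ X` is monotone. -/
def IsMonotone {X : Type*} [NormedAddCommGroup X] [InnerProductSpace ℝ X]
    (A : X → Set X) : Prop :=
  ∀ x y : X, ∀ u ∈ A x, ∀ v ∈ A y, 0 ≤ inner ℝ (x - y) (u - v)

/-- `A` is monotone and its graph is not properly contained in the graph of another monotone
operator. The order on `X → Set X` is pointwise inclusion, that is, inclusion of graphs. -/
def IsMaximallyMonotone {X : Type*} [NormedAddCommGroup X] [InnerProductSpace ℝ X]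
    (A : X → Set X) : Prop :=
  Maximal IsMonotone A

/-- The set of zeros of the operator `A`. -/
def zer {X : Type*} [Zero X] (A : X → Set X) : Set X :=
  {x | (0 : X) ∈ A x}

/-- The resolvent average `C_γ` of `C` and the normal cone operator of `{w}`:
`C_γ x = C (γ⁻¹ (x - (1 - γ) w)) + γ⁻¹ (1 - γ) (x - w)`. -/
def resolventAverage {X : Type*} [NormedAddCommGroup X] [InnerProductSpace ℝ X]
    (C : X → Set X) (w : X) (γ : ℝ) : X → Set X :=
  fun x => C (γ⁻¹ • (x - (1 - γ) • w)) + {(γ⁻¹ * (1 - γ)) • (x - w)}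

/-- The set of best approximations to `w` from `S`. -/
def nearestPoints {X : Type*} [NormedAddCommGroup X] (S : Set X) (w : X) : Set X :=
  {p | p ∈ S ∧ ∀ y ∈ S, ‖w - p‖ ≤ ‖w - y‖}

/-- `p = P_S w`: the point `p` is the unique best approximation to `w` from `S`. -/
def IsProjection {X : Type*} [NormedAddCommGroup X] (S : Set X) (w p : X) : Prop :=
  nearestPoints S w = {p}

end SetValuedOp

/-! With `x_γ = w + γ⁻¹ (z_γ - w)`, the point `z_γ` is a zero of `A_γ + B_γ` exactly when
`2 (1 - γ) (w - x_γ) ∈ (A + B) x_γ`, that is, when `x_γ` is the resolvent of `(2 (1 - γ))⁻¹ (A + B)`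
at `w`. Minty's theorem provides `x_γ`, and everything else rests on one consequence of
monotonicity: if `ε (w - x) ∈ C x` and `δ (w - y) ∈ C y` with `0 ≤ ε < δ`, then
`‖x - y‖² + ‖y - w‖² ≤ ‖x - w‖²`. For `ε > 0` it shows that the curve of resolvents is Cauchy as
soon as it is bounded; for `ε = 0` it compares the curve with the zeros of `C`.

For Minty's theorem, `(x, -x)` is monotonically related to `(y, v)` exactly when
`‖x - (y - v) / 2‖² ≤ ‖(y - v) / 2‖² + ⟪y, v⟫`. The right-hand side extends to a nonnegative
function on the convex hull of the points `(y, v, ⟪y, v⟫)`, and the limit `x` of the images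
`(y - v) / 2` along a minimizing sequence satisfies all these inequalities at once. -/

section ConvexMinimization

theorem le_sqrt_add_sqrt_of_forall_mul_sq_le {d u v : ℝ}
    (h : ∀ t ∈ Ioo (0 : ℝ) 1, t * (1 - t) * d ^ 2 ≤ (1 - t) * u + t * v) : d ≤ √u + √v := by
  refine le_of_forall_pos_le_add fun η hη => ?_
  set r := √u + η / 2
  set s := √v + η / 2
  have hr : 0 < r := by positivity
  have hs : 0 < s := by positivity
  have hur : u ≤ r ^ 2 := (Real.sqrt_le_left hr.le).1 (by simp only [r]; linarith)
  have hvs : v ≤ s ^ 2 := (Real.sqrt_le_left hs.le).1 (by simp only [s]; linarith)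
  -- this weight minimizes `r ^ 2 / t + s ^ 2 / (1 - t)`
  have ht : r / (r + s) ∈ Ioo (0 : ℝ) 1 :=
    ⟨by positivity, (div_lt_one (by positivity)).2 (by linarith)⟩
  have ht' : 1 - r / (r + s) = s / (r + s) := by field_simp; ring
  have hd := h _ ht
  rw [ht'] at hd
  have hsq : d ^ 2 ≤ (r + s) ^ 2 := by
    refine le_of_mul_le_mul_left (a := r / (r + s) * (s / (r + s))) ?_ (by positivity)
    calc r / (r + s) * (s / (r + s)) * d ^ 2
        ≤ s / (r + s) * u + r / (r + s) * v := hd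
      _ ≤ s / (r + s) * r ^ 2 + r / (r + s) * s ^ 2 := by gcongr
      _ = r / (r + s) * (s / (r + s)) * (r + s) ^ 2 := by field_simp
  calc d ≤ r + s := le_of_sq_le_sq hsq (by positivity)
    _ = √u + √v + η := by ring

theorem exists_forall_dist_le_sqrt_sub {ι E : Type*} [PseudoMetricSpace E] [CompleteSpace E]
    {a : ι → E} {f : ι → ℝ} {m : ℝ} (hm : m ∈ closure (range f))
    (ha : ∀ i j, dist (a i) (a j) ≤ √(f i - m) + √(f j - m)) :
    ∃ x, ∀ i, dist x (a i) ≤ √(f i - m) := by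
  set l := comap f (𝓝 m)
  have : l.NeBot := comap_neBot_iff_frequently.2 (mem_closure_iff_frequently.1 hm)
  have hl : Tendsto (fun i => √(f i - m)) l (𝓝 0) := by
    simpa using (tendsto_comap (f := f) (x := 𝓝 m)).sub_const m |>.sqrt
  have hcauchy : Cauchy (l.map a) := by
    rw [cauchy_map_iff', tendsto_uniformity_iff_dist_tendsto_zero]
    refine squeeze_zero (fun _ => dist_nonneg) (fun p => ha p.1 p.2) ?_
    simpa using (hl.comp tendsto_fst).add (hl.comp tendsto_snd)
  obtain ⟨x, hx⟩ := cauchy_map_iff_exists_tendsto.1 hcauchy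
  refine ⟨x, fun j => ?_⟩
  have hbound := hl.add_const √(f j - m)
  rw [zero_add] at hbound
  exact le_of_tendsto_of_tendsto' (hx.dist tendsto_const_nhds) hbound fun i => ha i j

theorem norm_sq_convex_combination {X : Type*} [NormedAddCommGroup X] [InnerProductSpace ℝ X]
    (u v : X) (t : ℝ) : ‖(1 - t) • u + t • v‖ ^ 2 =
      (1 - t) * ‖u‖ ^ 2 + t * ‖v‖ ^ 2 - t * (1 - t) * ‖u - v‖ ^ 2 := by
  simp only [norm_add_sq_real, norm_sub_sq_real, norm_smul, real_inner_smul_left,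
    real_inner_smul_right, mul_pow, Real.norm_eq_abs, sq_abs]
  ring

theorem exists_forall_norm_sub_sq_le_of_convexOn {E X : Type*} [AddCommGroup E] [Module ℝ E]
    [NormedAddCommGroup X] [InnerProductSpace ℝ X] [CompleteSpace X] {K : Set E} {φ : E → ℝ}
    (hφ : ConvexOn ℝ K φ) (hK : K.Nonempty) (π : E →ₗ[ℝ] X) (h0 : ∀ k ∈ K, 0 ≤ ‖π k‖ ^ 2 + φ k) :
    ∃ x, ∀ k ∈ K, ‖x - π k‖ ^ 2 ≤ ‖π k‖ ^ 2 + φ k := by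
  set f : K → ℝ := fun k => ‖π k‖ ^ 2 + φ k
  set m := ⨅ k, f k
  have : Nonempty K := hK.to_subtype
  have hbdd : BddBelow (range f) := ⟨0, forall_mem_range.2 fun k => h0 k k.2⟩
  have hcomb : ∀ a b : K, ∀ t ∈ Ioo (0 : ℝ) 1,
      t * (1 - t) * ‖π a - π b‖ ^ 2 ≤ (1 - t) * (f a - m) + t * (f b - m) := by
    intro a b t ht
    have ht' : 0 ≤ 1 - t := sub_nonneg.2 ht.2.le
    have hmem := hφ.1 a.2 b.2 ht' ht.1.le (sub_add_cancel 1 t)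
    have hφ' := hφ.2 a.2 b.2 ht' ht.1.le (sub_add_cancel 1 t)
    have hm : m ≤ ‖π ((1 - t) • (a : E) + t • (b : E))‖ ^ 2 + φ ((1 - t) • (a : E) + t • (b : E)) :=
      ciInf_le hbdd ⟨_, hmem⟩
    rw [map_add, map_smul, map_smul, norm_sq_convex_combination] at hm
    simp only [smul_eq_mul] at hφ'
    simp only [f]
    linarith
  obtain ⟨x, hx⟩ := exists_forall_dist_le_sqrt_sub (a := fun k : K => π k)
    (csInf_mem_closure (range_nonempty f) hbdd) fun a b => by
      rw [dist_eq_norm]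
      exact le_sqrt_add_sqrt_of_forall_mul_sq_le (hcomb a b)
  refine ⟨x, fun k hk => ?_⟩
  have hmk : m ≤ f ⟨k, hk⟩ := ciInf_le hbdd _
  have hdist := (Real.le_sqrt dist_nonneg (sub_nonneg.2 hmk)).1 (hx ⟨k, hk⟩)
  rw [dist_eq_norm] at hdist
  exact hdist.trans (sub_le_self _ (le_ciInf fun k => h0 k k.2))

end ConvexMinimization

theorem forall_mem_convexHull_of_symmetric {E : Type*} [AddCommGroup E] [Module ℝ E]
    {r : E → E → Prop} (hr : ∀ a, Convex ℝ {b | r a b}) (hsymm : ∀ a b, r a b → r b a) {s : Set E}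
    (hs : ∀ a ∈ s, ∀ b ∈ s, r a b) : ∀ a ∈ convexHull ℝ s, ∀ b ∈ convexHull ℝ s, r a b := by
  have hleft : ∀ a ∈ s, ∀ b ∈ convexHull ℝ s, r a b := fun a ha =>
    convexHull_min (hs a ha) (hr a)
  exact fun a ha => convexHull_min (fun b hb => hsymm b a (hleft b hb a ha)) (hr a)

theorem tendsto_nhds_or_tendsto_cobounded_of_dist_sq_add_le {ι E : Type*} [SemilatticeSup ι]
    [Nonempty ι] [PseudoMetricSpace E] [CompleteSpace E] {x : ι → E} {w : E}
    (hx : ∀ i j, i ≤ j → dist (x j) (x i) ^ 2 + dist (x i) w ^ 2 ≤ dist (x j) w ^ 2) :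
    (∃ p, Tendsto x atTop (𝓝 p)) ∨ Tendsto x atTop (Bornology.cobounded E) := by
  have hmono : Monotone fun i => dist (x i) w ^ 2 := fun i j hij => by
    linarith [hx i j hij, sq_nonneg (dist (x j) (x i))]
  rcases tendsto_atTop_of_monotone hmono with htop | ⟨r, hr⟩
  · right
    rw [← Metric.tendsto_dist_right_atTop_iff w]
    exact (Real.tendsto_sqrt_atTop.comp htop).congr fun i => Real.sqrt_sq dist_nonneg
  · left
    refine cauchySeq_tendsto_of_complete (Metric.cauchySeq_iff'.2 fun ε hε => ?_)
    obtain ⟨N, hN⟩ := (hr.eventually (lt_mem_nhds (sub_lt_self r (pow_pos hε 2)))).exists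
    refine ⟨N, fun n hn => lt_of_pow_lt_pow_left₀ 2 hε.le ?_⟩
    linarith [hx N n hn, hmono.ge_of_tendsto hr n]

section Homothety

open AffineMap

variable {E : Type*} [NormedAddCommGroup E] [NormedSpace ℝ E] {w : E}

theorem homothety_surjective (w : E) {c : ℝ} (hc : c ≠ 0) :
    Function.Surjective (homothety w c) := fun z =>
  ⟨homothety w c⁻¹ z, (homothety_eq_iff_of_mul_eq_one (mul_inv_cancel₀ hc)).2 rfl⟩

variable {ι : Type*} {l : Filter ι} {c : ι → ℝ} {x : ι → E}

theorem tendsto_homothety_nhds {r : ℝ} {p : E} (hc : Tendsto c l (𝓝 r)) (hx : Tendsto x l (𝓝 p)) :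
    Tendsto (fun i => homothety w (c i) (x i)) l (𝓝 (homothety w r p)) := by
  simp only [homothety_eq_lineMap]
  exact tendsto_const_nhds.lineMap hx hc

theorem tendsto_homothety_cobounded {r : ℝ} (hr : r ≠ 0) (hc : Tendsto c l (𝓝 r))
    (hx : Tendsto x l (Bornology.cobounded E)) :
    Tendsto (fun i => homothety w (c i) (x i)) l (Bornology.cobounded E) := by
  rw [← Metric.tendsto_dist_left_atTop_iff w] at hx ⊢
  simp only [dist_center_homothety]
  exact hc.norm.pos_mul_atTop (norm_pos_iff.2 hr) hx

end Homothety

namespace SetValuedOp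

theorem isProjection_of_forall_norm_sub_sq_add_le {X : Type*} [NormedAddCommGroup X] {S : Set X}
    {w p : X} (hp : p ∈ S) (h : ∀ y ∈ S, ‖y - p‖ ^ 2 + ‖p - w‖ ^ 2 ≤ ‖y - w‖ ^ 2) :
    IsProjection S w p := by
  refine Subset.antisymm (fun q hq => ?_) (singleton_subset_iff.2 ⟨hp, fun y hy => ?_⟩)
  · have hqp : ‖q - w‖ ^ 2 ≤ ‖p - w‖ ^ 2 := by
      rw [norm_sub_rev q, norm_sub_rev p]
      exact pow_le_pow_left₀ (norm_nonneg _) (hq.2 p hp) 2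
    have hsq : ‖q - p‖ ^ 2 = 0 := le_antisymm (by linarith [h q hq.1]) (sq_nonneg _)
    exact sub_eq_zero.1 (norm_eq_zero.1 (sq_eq_zero_iff.1 hsq))
  · rw [norm_sub_rev w p, norm_sub_rev w y]
    exact le_of_sq_le_sq (by linarith [h y hy, sq_nonneg ‖y - p‖]) (norm_nonneg _)

variable {X : Type*} [NormedAddCommGroup X] [InnerProductSpace ℝ X] {C : X → Set X}

/-- `x` is a zero of the Tikhonov regularization `C + ε (Id - w)` of `C`; for `ε > 0` this says that
`x` is the value at `w` of the resolvent of `ε⁻¹ C`, and for `ε = 0` that `x` is a zero of `C`. -/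
def IsRegularizedZero (C : X → Set X) (w : X) (ε : ℝ) (x : X) : Prop :=
  ε • (w - x) ∈ C x

theorem isRegularizedZero_zero_iff {w x : X} : IsRegularizedZero C w 0 x ↔ x ∈ zer C := by
  simp only [IsRegularizedZero, zero_smul, zer, mem_ofPred_eq]

section MaximalMonotonicity

theorem IsMaximallyMonotone.mem_of_forall_inner_nonneg (hC : IsMaximallyMonotone C) {x u : X}
    (h : ∀ y, ∀ v ∈ C y, 0 ≤ inner ℝ (x - y) (u - v)) : u ∈ C x := by
  have hmono : IsMonotone (fun y => C y ∪ {v | y = x ∧ v = u}) := by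
    rintro a b p (hp | ⟨rfl, rfl⟩) q (hq | ⟨rfl, rfl⟩)
    · exact hC.1 a b p hp q hq
    · rw [← neg_sub b a, ← neg_sub q p, inner_neg_neg]
      exact h a p hp
    · exact h b q hq
    · rw [sub_self, inner_zero_left]
  exact hC.2 hmono (fun y => subset_union_left) x (Or.inr ⟨rfl, rfl⟩)

theorem IsMaximallyMonotone.mem_of_tendsto (hC : IsMaximallyMonotone C) {ι : Type*} {l : Filter ι}
    [l.NeBot] {x u : ι → X} {p q : X} (hx : Tendsto x l (𝓝 p)) (hu : Tendsto u l (𝓝 q))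
    (h : ∀ᶠ i in l, u i ∈ C (x i)) : q ∈ C p :=
  hC.mem_of_forall_inner_nonneg fun y v hv =>
    ge_of_tendsto ((hx.sub_const y).inner (hu.sub_const v))
      (h.mono fun i hi => hC.1 (x i) y (u i) hi v hv)

end MaximalMonotonicity

section Minty

/-- The graph of `C`, each of its points `(y, v)` being lifted to `(y, v, ⟪y, v⟫)`. Monotonicity
of `C` survives on the convex hull of the lifted graph, see `inner_le_of_mem_convexHull`. -/
def liftedGraph (C : X → Set X) : Set (X × X × ℝ) :=
  {c | c.2.1 ∈ C c.1 ∧ c.2.2 = inner ℝ c.1 c.2.1}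

theorem IsMonotone.inner_le_of_mem_convexHull (hC : IsMonotone C) {c : X × X × ℝ}
    (hc : c ∈ convexHull ℝ (liftedGraph C)) : inner ℝ c.1 c.2.1 ≤ c.2.2 := by
  -- the diagonal of this condition, which is affine in `a` and in `b`, is the claim
  let r : X × X × ℝ → X × X × ℝ → Prop := fun a b =>
    inner ℝ a.1 b.2.1 + inner ℝ a.2.1 b.1 - b.2.2 ≤ a.2.2
  have hconvex : ∀ a, Convex ℝ {b | r a b} := fun a => by
    refine convex_halfSpace_le ⟨fun b b' => ?_, fun t b => ?_⟩ a.2.2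
    · simp only [Prod.fst_add, Prod.snd_add, inner_add_right]
      ring
    · simp only [Prod.smul_fst, Prod.smul_snd, real_inner_smul_right, smul_eq_mul]
      ring
  have hsymm : ∀ a b, r a b → r b a := fun a b h => by
    simp only [r] at h ⊢
    rw [real_inner_comm a.2.1 b.1, real_inner_comm a.1 b.2.1]
    linarith
  have hgraph : ∀ a ∈ liftedGraph C, ∀ b ∈ liftedGraph C, r a b := by
    rintro a ⟨hva, ha⟩ b ⟨hvb, hb⟩
    have h := hC a.1 b.1 a.2.1 hva b.2.1 hvb
    simp only [inner_sub_left, inner_sub_right] at h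
    simp only [r]
    rw [ha, hb, real_inner_comm b.1 a.2.1]
    linarith
  have hdiag : inner ℝ c.1 c.2.1 + inner ℝ c.2.1 c.1 - c.2.2 ≤ c.2.2 :=
    forall_mem_convexHull_of_symmetric hconvex hsymm hgraph c hc c hc
  rw [real_inner_comm c.1 c.2.1] at hdiag
  linarith

theorem IsMonotone.exists_forall_inner_nonneg [CompleteSpace X] (hC : IsMonotone C) :
    ∃ x, ∀ y, ∀ v ∈ C y, 0 ≤ inner ℝ (x - y) (-x - v) := by
  have hgraph : ∀ y, ∀ v ∈ C y, (y, v, inner ℝ y v) ∈ liftedGraph C := fun y v hv => ⟨hv, rfl⟩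
  rcases (liftedGraph C).eq_empty_or_nonempty with hempty | hne
  · exact ⟨0, fun y v hv => absurd (hgraph y v hv) (hempty ▸ notMem_empty _)⟩
  let π : X × X × ℝ →ₗ[ℝ] X :=
    (1 / 2 : ℝ) • (LinearMap.fst ℝ X (X × ℝ) - LinearMap.fst ℝ X ℝ ∘ₗ LinearMap.snd ℝ X (X × ℝ))
  let φ : X × X × ℝ →ₗ[ℝ] ℝ := LinearMap.snd ℝ X ℝ ∘ₗ LinearMap.snd ℝ X (X × ℝ)
  have hsq : ∀ c, ‖π c‖ ^ 2 = (1 / 4) * ‖c.1 + c.2.1‖ ^ 2 - inner ℝ c.1 c.2.1 := fun c => by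
    change ‖(1 / 2 : ℝ) • (c.1 - c.2.1)‖ ^ 2 = _
    rw [norm_smul, mul_pow, norm_sub_sq_real, norm_add_sq_real, Real.norm_eq_abs, sq_abs]
    ring
  obtain ⟨x, hx⟩ := exists_forall_norm_sub_sq_le_of_convexOn
    (φ.convexOn (convex_convexHull ℝ (liftedGraph C))) hne.convexHull π fun c hc => by
      have hφ : inner ℝ c.1 c.2.1 ≤ φ c := hC.inner_le_of_mem_convexHull hc
      rw [hsq]
      linarith [sq_nonneg ‖c.1 + c.2.1‖]
  refine ⟨x, fun y v hv => ?_⟩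
  have h : ‖x - (1 / 2 : ℝ) • (y - v)‖ ^ 2 ≤ ‖(1 / 2 : ℝ) • (y - v)‖ ^ 2 + inner ℝ y v :=
    hx (y, v, inner ℝ y v) (subset_convexHull ℝ _ (hgraph y v hv))
  rw [norm_sub_sq_real, real_inner_smul_right, inner_sub_right] at h
  rw [inner_sub_left, inner_sub_right, inner_sub_right, inner_neg_right, inner_neg_right,
    real_inner_self_eq_norm_sq, real_inner_comm x y]
  linarith

theorem IsMaximallyMonotone.exists_isRegularizedZero [CompleteSpace X]
    (hC : IsMaximallyMonotone C) (w : X) {ε : ℝ} (hε : 0 < ε) : ∃ x, IsRegularizedZero C w ε x := by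
  have hscaled : IsMonotone fun y => {v | ε • v ∈ C (y + w)} := by
    intro x y u hu v hv
    have h := hC.1 _ _ _ hu _ hv
    rw [add_sub_add_right_eq_sub, ← smul_sub, real_inner_smul_right] at h
    exact nonneg_of_mul_nonneg_right h hε
  obtain ⟨x, hx⟩ := hscaled.exists_forall_inner_nonneg
  refine ⟨x + w, hC.mem_of_forall_inner_nonneg fun y v hv => ?_⟩
  have h := hx (y - w) (ε⁻¹ • v) (by simpa [smul_inv_smul₀ hε.ne'] using hv)
  have hpoint : x + w - y = x - (y - w) := by abel
  have hvalue : ε • (w - (x + w)) - v = ε • (-x - ε⁻¹ • v) := by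
    rw [smul_sub ε (-x), smul_inv_smul₀ hε.ne', sub_add_cancel_right]
  rw [hpoint, hvalue, real_inner_smul_right]
  exact mul_nonneg hε.le h

end Minty

section Resolvent

variable {w x y : X} {ε δ : ℝ}

theorem IsMonotone.mul_norm_sub_sq_le (hC : IsMonotone C) (hx : IsRegularizedZero C w ε x)
    (hy : IsRegularizedZero C w δ y) :
    ε * ‖x - y‖ ^ 2 ≤ (δ - ε) * inner ℝ (x - y) (y - w) := by
  have h := hC x y _ hx _ hy
  have hdiff : ε • (w - x) - δ • (w - y) = (δ - ε) • (y - w) - ε • (x - y) := by module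
  rw [hdiff, inner_sub_right, real_inner_smul_right, real_inner_smul_right,
    real_inner_self_eq_norm_sq] at h
  linarith

theorem IsMonotone.isRegularizedZero_unique (hC : IsMonotone C) (hε : 0 < ε)
    (hx : IsRegularizedZero C w ε x) (hy : IsRegularizedZero C w ε y) : x = y := by
  have h := hC.mul_norm_sub_sq_le hx hy
  rw [sub_self, zero_mul] at h
  have hsq : ‖x - y‖ ^ 2 = 0 := le_antisymm (nonpos_of_mul_nonpos_right h hε) (sq_nonneg _)
  exact sub_eq_zero.1 (norm_eq_zero.1 (sq_eq_zero_iff.1 hsq))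

theorem IsMonotone.norm_sub_sq_add_le (hC : IsMonotone C) (hε : 0 ≤ ε) (hεδ : ε < δ)
    (hx : IsRegularizedZero C w ε x) (hy : IsRegularizedZero C w δ y) :
    ‖x - y‖ ^ 2 + ‖y - w‖ ^ 2 ≤ ‖x - w‖ ^ 2 := by
  have hinner : 0 ≤ inner ℝ (x - y) (y - w) :=
    nonneg_of_mul_nonneg_right
      ((mul_nonneg hε (sq_nonneg _)).trans (hC.mul_norm_sub_sq_le hx hy)) (sub_pos.2 hεδ)
  rw [← sub_add_sub_cancel x y w, norm_add_sq_real]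
  linarith

theorem IsMaximallyMonotone.isProjection_of_tendsto (hC : IsMaximallyMonotone C) {ι : Type*}
    {l : Filter ι} [l.NeBot] {p : X} {ε : ι → ℝ} {x : ι → X} (hε : Tendsto ε l (𝓝 0))
    (hx : Tendsto x l (𝓝 p)) (hpos : ∀ i, 0 < ε i) (h : ∀ i, IsRegularizedZero C w (ε i) (x i)) :
    IsProjection (zer C) w p := by
  refine isProjection_of_forall_norm_sub_sq_add_le ?_ fun y hy => ?_
  · rw [← isRegularizedZero_zero_iff (w := w)]
    exact hC.mem_of_tendsto hx (hε.smul (hx.const_sub w)) (Eventually.of_forall h)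
  · exact le_of_tendsto' (((hx.const_sub y).norm.pow 2).add ((hx.sub_const w).norm.pow 2))
      fun i => hC.1.norm_sub_sq_add_le le_rfl (hpos i) (isRegularizedZero_zero_iff.2 hy) (h i)

theorem IsMonotone.zer_eq_empty_of_tendsto_cobounded (hC : IsMonotone C) {ι : Type*}
    {l : Filter ι} [l.NeBot] {ε : ι → ℝ} {x : ι → X} (hx : Tendsto x l (Bornology.cobounded X))
    (hpos : ∀ i, 0 < ε i) (h : ∀ i, IsRegularizedZero C w (ε i) (x i)) : zer C = ∅ := by
  refine eq_empty_of_forall_notMem fun y hy => ?_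
  have hdist := (Metric.tendsto_dist_right_atTop_iff w).2 hx
  obtain ⟨i, hi⟩ := (hdist.eventually_gt_atTop (dist y w)).exists
  have hle := hC.norm_sub_sq_add_le le_rfl (hpos i) (isRegularizedZero_zero_iff.2 hy) (h i)
  rw [dist_eq_norm, dist_eq_norm] at hi
  have hlt := pow_lt_pow_left₀ hi (norm_nonneg _) two_ne_zero
  linarith [sq_nonneg ‖y - x i‖]

theorem IsMaximallyMonotone.tendsto_projection_or_cobounded [CompleteSpace X]
    (hC : IsMaximallyMonotone C) {ι : Type*} [SemilatticeSup ι] [Nonempty ι] {ε : ι → ℝ}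
    {x : ι → X} (hpos : ∀ i, 0 < ε i) (hanti : Antitone ε) (hlim : Tendsto ε atTop (𝓝 0))
    (h : ∀ i, IsRegularizedZero C w (ε i) (x i)) :
    (∃ p, IsProjection (zer C) w p ∧ Tendsto x atTop (𝓝 p)) ∨
      (zer C = ∅ ∧ Tendsto x atTop (Bornology.cobounded X)) := by
  have hdist : ∀ i j, i ≤ j → dist (x j) (x i) ^ 2 + dist (x i) w ^ 2 ≤ dist (x j) w ^ 2 := by
    intro i j hij
    simp only [dist_eq_norm]
    rcases (hanti hij).lt_or_eq with hlt | heq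
    · exact hC.1.norm_sub_sq_add_le (hpos j).le hlt (h j) (h i)
    · have hxj := h j
      rw [heq] at hxj
      simp [hC.1.isRegularizedZero_unique (hpos i) hxj (h i)]
  rcases tendsto_nhds_or_tendsto_cobounded_of_dist_sq_add_le hdist with ⟨p, hp⟩ | htop
  · exact Or.inl ⟨p, hC.isProjection_of_tendsto hlim hp hpos h, hp⟩
  · exact Or.inr ⟨hC.1.zer_eq_empty_of_tendsto_cobounded htop hpos h, htop⟩

end Resolvent

section ResolventAverage

open AffineMap

variable {A B : X → Set X} {w : X} {γ : ℝ}

theorem homothety_mem_zer_resolventAverage_add_iff (hγ : γ ≠ 0) {x : X} :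
    homothety w γ x ∈ zer (fun x => resolventAverage A w γ x + resolventAverage B w γ x) ↔
      IsRegularizedZero (fun x => A x + B x) w (2 * (1 - γ)) x := by
  have hpoint : γ⁻¹ • (homothety w γ x - (1 - γ) • w) = x := by
    rw [homothety_apply, vsub_eq_sub, vadd_eq_add]
    match_scalars
    · field_simp
    · ring
  have hshift : (γ⁻¹ * (1 - γ)) • (homothety w γ x - w) = (1 - γ) • (x - w) := by
    rw [homothety_apply, vsub_eq_sub, vadd_eq_add, add_sub_cancel_right, smul_smul]
    congr 1
    field_simp
  have hvalue : (2 * (1 - γ)) • (w - x) = -((1 - γ) • (x - w) + (1 - γ) • (x - w)) := by module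
  simp only [zer, resolventAverage, IsRegularizedZero, mem_ofPred_eq]
  rw [hpoint, hshift, hvalue, add_add_add_comm, singleton_add_singleton, add_singleton]
  simp only [mem_image, ← eq_neg_iff_add_eq_zero, exists_eq_right]

theorem IsMaximallyMonotone.existsUnique_mem_zer_resolventAverage_add [CompleteSpace X]
    (hAB : IsMaximallyMonotone fun x => A x + B x) (hγ : γ ∈ Ioo (0 : ℝ) 1) :
    ∃! z, z ∈ zer fun x => resolventAverage A w γ x + resolventAverage B w γ x := by
  have hpos : 0 < 2 * (1 - γ) := by linarith [hγ.2]
  obtain ⟨x, hx⟩ := hAB.exists_isRegularizedZero w hpos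
  refine ⟨homothety w γ x, (homothety_mem_zer_resolventAverage_add_iff hγ.1.ne').2 hx,
    fun z hz => ?_⟩
  obtain ⟨y, rfl⟩ := homothety_surjective w hγ.1.ne' z
  rw [hAB.1.isRegularizedZero_unique hpos
    ((homothety_mem_zer_resolventAverage_add_iff hγ.1.ne').1 hz) hx]

theorem IsMaximallyMonotone.tendsto_projection_or_cobounded_of_mem_zer [CompleteSpace X]
    (hAB : IsMaximallyMonotone fun x => A x + B x) {z : ℝ → X}
    (hz : ∀ γ ∈ Ioo (0 : ℝ) 1,
      z γ ∈ zer fun x => resolventAverage A w γ x + resolventAverage B w γ x) :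
    (∃ p, IsProjection (zer fun x => A x + B x) w p ∧ Tendsto z (𝓝[<] 1) (𝓝 p)) ∨
      ((zer fun x => A x + B x) = ∅ ∧ Tendsto z (𝓝[<] 1) (Bornology.cobounded X)) := by
  have : Nonempty (Ioo (0 : ℝ) 1) := ⟨⟨1 / 2, by norm_num⟩⟩
  choose x hx using fun γ : Ioo (0 : ℝ) 1 => homothety_surjective w γ.2.1.ne' (z γ)
  have hreg : ∀ γ : Ioo (0 : ℝ) 1,
      IsRegularizedZero (fun x => A x + B x) w (2 * (1 - γ)) (x γ) := fun γ => by
    rw [← homothety_mem_zer_resolventAverage_add_iff γ.2.1.ne', hx]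
    exact hz γ γ.2
  have hanti : Antitone fun γ : Ioo (0 : ℝ) 1 => 2 * (1 - (γ : ℝ)) := fun γ γ' h =>
    mul_le_mul_of_nonneg_left (sub_le_sub_left (Subtype.coe_le_coe.2 h) 1) zero_le_two
  have hγ : Tendsto (fun γ : Ioo (0 : ℝ) 1 => (γ : ℝ)) atTop (𝓝 1) :=
    (tendsto_comp_coe_Ioo_atTop one_pos).2 (tendsto_id.mono_left nhdsWithin_le_nhds)
  have hε : Tendsto (fun γ : Ioo (0 : ℝ) 1 => 2 * (1 - (γ : ℝ))) atTop (𝓝 0) := by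
    simpa using (hγ.const_sub 1).const_mul 2
  simp only [← tendsto_comp_coe_Ioo_atTop (zero_lt_one' ℝ), ← hx]
  rcases hAB.tendsto_projection_or_cobounded (fun γ => by linarith [γ.2.2]) hanti hε hreg with
    ⟨p, hp, hlim⟩ | ⟨hempty, hlim⟩
  · exact Or.inl ⟨p, hp, by simpa using tendsto_homothety_nhds (w := w) hγ hlim⟩
  · exact Or.inr ⟨hempty, tendsto_homothety_cobounded one_ne_zero hγ hlim⟩

end ResolventAverage

end SetValuedOp

theorem theorem3p4_general {X : Type*} [NormedAddCommGroup X] [InnerProductSpace ℝ X]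
    [CompleteSpace X]
    (A B : X → Set X) (w : X)
    (hAB : SetValuedOp.IsMaximallyMonotone (fun x => A x + B x)) :
    (∀ γ ∈ Ioo (0 : ℝ) 1, ∃! z : X,
      z ∈ SetValuedOp.zer (fun x => SetValuedOp.resolventAverage A w γ x +
        SetValuedOp.resolventAverage B w γ x)) ∧
    ∀ z : ℝ → X,
      (∀ γ ∈ Ioo (0 : ℝ) 1,
        SetValuedOp.zer (fun x => SetValuedOp.resolventAverage A w γ x +
          SetValuedOp.resolventAverage B w γ x) = {z γ}) →
      Xor
        ((SetValuedOp.zer (fun x => A x + B x)).Nonempty ∧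
          ∃ p : X, SetValuedOp.IsProjection (SetValuedOp.zer (fun x => A x + B x)) w p ∧
            Tendsto z (𝓝[<] 1) (𝓝 p))
        (SetValuedOp.zer (fun x => A x + B x) = ∅ ∧
          Tendsto (fun γ => ‖z γ‖) (𝓝[<] 1) atTop) := by
  refine ⟨fun γ hγ => hAB.existsUnique_mem_zer_resolventAverage_add hγ, fun z hz => ?_⟩
  rw [tendsto_norm_atTop_iff_cobounded]
  rcases hAB.tendsto_projection_or_cobounded_of_mem_zer fun γ hγ => (hz γ hγ).ge rfl with
    ⟨p, hp, hlim⟩ | ⟨hempty, hlim⟩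
  · have hne : (SetValuedOp.zer fun x => A x + B x).Nonempty := ⟨p, (hp.ge rfl).1⟩
    exact Or.inl ⟨⟨hne, p, hp, hlim⟩, fun h => hne.ne_empty h.1⟩
  · exact Or.inr ⟨⟨hempty, hlim⟩, fun h => h.1.ne_empty hempty⟩

theorem theorem3p4 {X : Type*} [NormedAddCommGroup X] [InnerProductSpace ℝ X] [CompleteSpace X]
    (A B : X → Set X) (w : X)
    (hA : SetValuedOp.IsMaximallyMonotone A)
    (hB : SetValuedOp.IsMaximallyMonotone B)
    (hAB : SetValuedOp.IsMaximallyMonotone (fun x => A x + B x)) :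
    (∀ γ ∈ Ioo (0 : ℝ) 1, ∃! z : X,
      z ∈ SetValuedOp.zer (fun x => SetValuedOp.resolventAverage A w γ x +
        SetValuedOp.resolventAverage B w γ x)) ∧
    ∀ z : ℝ → X,
      (∀ γ ∈ Ioo (0 : ℝ) 1,
        SetValuedOp.zer (fun x => SetValuedOp.resolventAverage A w γ x +
          SetValuedOp.resolventAverage B w γ x) = {z γ}) →
      Xor
        ((SetValuedOp.zer (fun x => A x + B x)).Nonempty ∧
          ∃ p : X, SetValuedOp.IsProjection (SetValuedOp.zer (fun x => A x + B x)) w p ∧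
            Tendsto z (𝓝[<] 1) (𝓝 p))
        (SetValuedOp.zer (fun x => A x + B x) = ∅ ∧
          Tendsto (fun γ => ‖z γ‖) (𝓝[<] 1) atTop) :=
  theorem3p4_general A B w hAB
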